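/- Setting. Consider $x(k+1)=f(x(k),u(k),w(k))$ with $f:\mathbb R^n\times\mathbb R^m\times\mathbb R^p\to\mathbb R^n$ continuous, an input set $\mathcal U\subseteq\mathbb R^m$ and a state constraint function $c_x:\mathbb R^n\to\mathbb R^{n_x}$. Vector inequalities are elementwise, norms are Euclidean, and $\|x\|_{\mathcal S}=\inf_{y\in\mathcal S}\|x-y\|$. Let $N\ge 1$, $0=\Delta_0<\Delta_1<\dots<\Delta_{N-1}$, $\gamma_f>0$. Assumptions. (i) $\mathcal U$ is compact, $c_x$ is continuous, and $\{x\mid c_x(x)\le\xi\}$ is compact for every $\xi\ge 0$. (ii) $h_f:\mathbb R^n\to\mathbb R$ is continuous and is a terminal control barrier function on $\mathcal D_f=\{h_f\le\gamma_f\}$ with safe set $\mathcal S_f=\{h_f\le 0\}$: both sets are compact and non-empty, there is a continuous $\Delta h_f:\mathcal D_f\to\mathbb R$, positive on $\mathcal D_f\setminus\mathcal S_f$, with $\inf\{h_f(f(x,u,0))\mid u\in\mathcal U,\ f(x,u,0)\in\mathcal D_f\}\le h_f(x)-\Delta h_f(x)$ for $x\in\mathcal D_f\setminus\mathcal S_f$,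 and $\inf\{h_f(f(x,u,0))\mid u\in\mathcal U,\ f(x,u,0)\in\mathcal D_f\}\le 0$ for $x\in\mathcal S_f$ (an infimum over the empty set is $+\infty$). Moreover $c_x(x)<-\Delta_{N-1}\mathbf 1$ for all $x\in\mathcal S_f$. Predictive control barrier function. For $\alpha_f>0$ let $h_{\mathrm{PB}}(x)$ be the minimum of $\alpha_f\xi_N+\sum_{i=0}^{N-1}\|\xi_i\|$ over states $x_i$, inputs $u_i$ and slacks $\xi_i\in\mathbb R^{n_x}$ $(i<N)$, $\xi_N\in\mathbb R$, subject to $x_0=x$, $x_{i+1}=f(x_i,u_i,0)$, $u_i\in\mathcal U$, $c_x(x_i)\le-\Delta_i\mathbf 1+\xi_i$, $\xi_i\ge 0$ for $i<N$, and $h_f(x_N)\le\xi_N$, $\xi_N\ge 0$. Put $\mathcal D_{\mathrm{PB}}=\{h_{\mathrm{PB}}\le\alpha_f\gamma_f\}$ and $\mathcal S_{\mathrm{PB}}=\{h_{\mathrm{PB}}=0\}$. Approximate-PCBF safety filter. Let $\hat h:\mathbb R^n\to\mathbb R$ be continuous and $c_\Delta\in(0,1]$. Put $\Delta\hat h(x)=\max_{u\in\mathcal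 U}(\hat h(x)-\hat h(f(x,u,0)))$, and let $c(x)=1$ if $\Delta\hat h(x)<0$, $c(x)=c_\Delta$ otherwise. In state $x$, given an arbitrary proposed input $u_{\mathrm p}\in\mathbb R^m$, the filter applies $u=u_{\mathrm p}$ if $u_{\mathrm p}\in\mathcal U$ and $\hat h(f(x,u_{\mathrm p},0))\le 0$; otherwise it applies a minimiser $u$ of $\|u-u_{\mathrm p}\|$ over all $u\in\mathcal U$ with $\hat h(f(x,u,0))-\hat h(x)\le-c(x)\Delta\hat h(x)$. Let $\hat F(x,w)$ be the set of all $f(x,u,w)$ with $u$ an input that the filter may apply in $x$ for some proposed $u_{\mathrm p}$. Original PCBF algorithm. In state $x$, given an arbitrary $u_{\mathrm p}\in\mathbb R^m$, it first computes optimal slacks $\xi_i^*,\xi_N^*$ of the problem defining $h_{\mathrm{PB}}(x)$, then minimises $\|u_0-u_{\mathrm p}\|$ over all $x_i,u_i$ satisfying the same constraints with the slacks fixed to $\xi_i^*,\xi_N^*$, and applies the first input $u_0$ of a minimiser. Let $F_{\mathrm{PB}}(x,w)$ be the set of the resulting successor states $f(x,u_0,w)$. Let $\mathcal W\subset\mathbb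 R^p$ always denote a compact set of possible disturbances with $0\in\mathcal W$. A set $\mathcal A$ is robustly positively invariant for $x(k+1)\in F(x(k),w(k))$ if $F(x,w)\subseteq\mathcal A$ for all $x\in\mathcal A$, $w\in\mathcal W$. A function $\sigma:[0,\infty)\to[0,\infty)$ is of class $\mathcal K$ if it is continuous, strictly increasing and $\sigma(0)=0$; $\beta:[0,\infty)\times\mathbb N\to[0,\infty)$ is of class $\mathcal{KL}$ if each $\beta(\cdot,t)$ is of class $\mathcal K$ and each $\beta(s,\cdot)$ is non-increasing with limit $0$. Theorem. Under (i) and (ii) there is $\bar\alpha>0$ such that for every $\alpha_f\ge\bar\alpha$ the following hold. (a) For every $c_\Delta\in(0,1]$ there are $\beta\in\mathcal{KL}$ and $\sigma\in\mathcal K$ such that for every continuous $\hat h:\mathbb R^n\to\mathbb R$, every $\epsilon_h$ with $|h_{\mathrm{PB}}(x)-\hat h(x)|\le\epsilon_h$ for all $x\in\mathcal D_{\mathrm{PB}}$, and every $\mathcal W$ for which $\mathcal D_{\mathrm{PB}}$ is robustly positively invariant for $\hat F$, the closed loop $x(k+1)\in\hat F(x(k),w(k))$ is input-to-state stable in $\mathcal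 D_{\mathrm{PB}}$ with respect to $\mathcal S_{\mathrm{PB}}$, with the disturbance and the approximation error as inputs. That is: $\mathcal S_{\mathrm{PB}}\subseteq\mathcal D_{\mathrm{PB}}$ are compact and non-empty; if $\epsilon_h=0$ then $\hat F(x,0)\subseteq\mathcal S_{\mathrm{PB}}$ for all $x\in\mathcal S_{\mathrm{PB}}$; and for every sequence $w(k)\in\mathcal W$, every solution with $x(0)\in\mathcal D_{\mathrm{PB}}$ and every $i\in\mathbb N$, $$\|x(i)\|_{\mathcal S_{\mathrm{PB}}}\le\beta(\|x(0)\|_{\mathcal S_{\mathrm{PB}}},i)+\sigma\Bigl(\max\Bigl\{\sup_{j<i}\|w(j)\|,\ \epsilon_h\Bigr\}\Bigr),$$ where the supremum is $0$ for $i=0$. (b) The original PCBF algorithm is input-to-state stable: there are $\beta\in\mathcal{KL}$ and $\sigma\in\mathcal K$ such that, for every $\mathcal W$ for which $\mathcal D_{\mathrm{PB}}$ is robustly positively invariant for $F_{\mathrm{PB}}$, the properties in (a) hold with $F_{\mathrm{PB}}$ in place of $\hat F$ and $\epsilon_h=0$. -/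

import Mathlib

namespace PCBF

/-- `ℝⁿ` with the Euclidean norm. -/
abbrev Vec (n : ℕ) : Type := EuclideanSpace ℝ (Fin n)

/-! ### Comparison functions -/

/-- Class `𝒦` functions on `[0, ∞)`. -/
structure IsClassK (α : ℝ → ℝ) : Prop where
  continuousOn : ContinuousOn α (Set.Ici 0)
  strictMonoOn : StrictMonoOn α (Set.Ici 0)
  map_zero : α 0 = 0

/-- Class `𝒦ℒ` functions on `[0, ∞) × ℕ` (as `ℕ` is discrete, joint continuity is continuity of
each `β (·, t)`, which is part of the first field). -/
structure IsClassKL (β : ℝ → ℕ → ℝ) : Prop where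
  classK : ∀ t, IsClassK fun s => β s t
  antitone : ∀ s, 0 ≤ s → Antitone (β s)
  tendsto_zero : ∀ s, 0 ≤ s → Filter.Tendsto (β s) Filter.atTop (nhds 0)

/-! ### Difference inclusions `x(k+1) ∈ F(x(k), w(k))` -/

section Inclusions

variable {n p : ℕ}

/-- `A` is robustly positively invariant for `x(k+1) ∈ F(x(k), w(k))`, `w(k) ∈ W`. -/
def RobustlyPositivelyInvariant (F : Vec n → Vec p → Set (Vec n)) (W : Set (Vec p))
    (A : Set (Vec n)) : Prop :=
  ∀ w ∈ W, ∀ x ∈ A, F x w ⊆ A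

/-- `x` is a solution of the inclusion under the disturbance sequence `w`. -/
def IsSolution (F : Vec n → Vec p → Set (Vec n)) (w : ℕ → Vec p) (x : ℕ → Vec n) : Prop :=
  ∀ k, x (k + 1) ∈ F (x k) (w k)

/-- The sup norm of the truncated sequence `(w(0), …, w(i-1))` (it is `0` for `i = 0`). -/
noncomputable def truncNorm (w : ℕ → Vec p) (i : ℕ) : ℝ :=
  ((Finset.range i).sup fun j => ‖w j‖₊ : NNReal)

/-- Input-to-state stability in `D` with respect to `S`, with the gains `β` and `σ`, where the
inputs are the disturbance sequence `w` (with values in `W`) and a further constant input of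
size `ε`. Zero input means `w = 0` and `ε = 0`. For `ε = 0` this is ordinary input-to-state
stability with respect to `w`. -/
structure IsISSWith (β : ℝ → ℕ → ℝ) (σ : ℝ → ℝ) (F : Vec n → Vec p → Set (Vec n))
    (W : Set (Vec p)) (D S : Set (Vec n)) (ε : ℝ) : Prop where
  isCompact_domain : IsCompact D
  invariant_domain : RobustlyPositivelyInvariant F W D
  isCompact_safe : IsCompact S
  nonempty_safe : S.Nonempty
  safe_subset : S ⊆ D
  zero_input_invariant : ε = 0 → ∀ x ∈ S, F x 0 ⊆ S
  estimate : ∀ w : ℕ → Vec p, (∀ k, w k ∈ W) → ∀ x : ℕ → Vec n, x 0 ∈ D → IsSolution F w x →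
    ∀ i, Metric.infDist (x i) S ≤
      β (Metric.infDist (x 0) S) i + σ (max (truncNorm w i) ε)

end Inclusions

/-! ### Control barrier functions -/

/-- Discrete-time control barrier function `h` on the domain `D`, with safe set `{h ≤ 0}`, for
`x(k+1) = f(x(k), u(k), 0)`, `u(k) ∈ U`. The infima are taken in the extended reals, so that an
infimum over the empty set is `+∞`; as `h` is only meaningful on `D`, both infima range over the
inputs that lead into `D`. -/
def IsCBF {n m p : ℕ} (f : Vec n → Vec m → Vec p → Vec n) (U : Set (Vec m))
    (h : Vec n → ℝ) (D : Set (Vec n)) : Prop :=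
  {x | h x ≤ 0} ⊆ D ∧
  IsCompact {x | h x ≤ 0} ∧ {x | h x ≤ 0}.Nonempty ∧ IsCompact D ∧ D.Nonempty ∧
  ContinuousOn h D ∧
  ∃ dh : Vec n → ℝ, ContinuousOn dh D ∧
    (∀ x ∈ D, 0 < h x → 0 < dh x) ∧
    (∀ x ∈ D, 0 < h x →
      (⨅ u ∈ {u ∈ U | f x u 0 ∈ D}, (h (f x u 0) : EReal)) ≤ ((h x - dh x : ℝ) : EReal)) ∧
    (∀ x, h x ≤ 0 →
      (⨅ u ∈ {u ∈ U | f x u 0 ∈ D}, (h (f x u 0) : EReal)) ≤ 0)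

/-! ### The predictive control barrier function -/

/-- The data of the control problem: dynamics `f`, input constraint set `U`, state constraint
function `c`, prediction horizon `N`, tightenings `tight i` (relevant for `i ≤ N - 1`), terminal
function `hf` and its level `γf`. -/
structure Problem (n m p q : ℕ) where
  f : Vec n → Vec m → Vec p → Vec n
  U : Set (Vec m)
  c : Vec n → Vec q
  N : ℕ
  tight : ℕ → ℝ
  hf : Vec n → ℝ
  γf : ℝ
  continuous_f : Continuous fun z : Vec n × Vec m × Vec p => f z.1 z.2.1 z.2.2
  one_le_N : 1 ≤ N
  tight_zero : tight 0 = 0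
  tight_lt : ∀ i, i + 1 < N → tight i < tight (i + 1)
  γf_pos : 0 < γf

namespace Problem

variable {n m p q : ℕ} (P : Problem n m p q)

/-- The soft-constrained set `𝒳(ξ) = {x | c(x) ≤ ξ}` (elementwise). -/
def softSet (ξ : Vec q) : Set (Vec n) := {x | ∀ j, P.c x j ≤ ξ j}

/-- The tightened soft-constrained set `{x | c(x) ≤ -Δᵢ 𝟏 + ξ}`. -/
def tightSet (i : ℕ) (ξ : Vec q) : Set (Vec n) := {x | ∀ j, P.c x j ≤ -P.tight i + ξ j}

/-- Assumption on the constraint sets. -/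
structure ConstraintSets : Prop where
  isCompact_U : IsCompact P.U
  isCompact_softSet : ∀ ξ : Vec q, (∀ j, 0 ≤ ξ j) → IsCompact (P.softSet ξ)
  continuous_c : Continuous P.c

/-- Domain `{hf ≤ γf}` of the terminal control barrier function. -/
def terminalDomain : Set (Vec n) := {x | P.hf x ≤ P.γf}

/-- Assumption on the terminal control barrier function: its safe set `{hf ≤ 0}` lies strictly
inside the tightened state constraints. -/
structure TerminalCBF : Prop where
  continuous_hf : Continuous P.hf
  isCBF : IsCBF P.f P.U P.hf P.terminalDomain
  safe_inside : ∀ x, P.hf x ≤ 0 → ∀ j, P.c x j < -P.tight (P.N - 1)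

/-- Constraints on predicted states `x₀, …, x_N` and inputs `u₀, …, u_{N-1}` from the initial
state `x`, for given slacks `ξ₀, …, ξ_{N-1}` and terminal slack `ξN`. Only the indicated entries
of the sequences matter. -/
structure FeasibleTraj (x : Vec n) (ξ : ℕ → Vec q) (ξN : ℝ) (xs : ℕ → Vec n) (us : ℕ → Vec m) :
    Prop where
  init : xs 0 = x
  dynamics : ∀ i < P.N, xs (i + 1) = P.f (xs i) (us i) 0
  input : ∀ i < P.N, us i ∈ P.U
  state : ∀ i < P.N, xs i ∈ P.tightSet i (ξ i)
  terminal : P.hf (xs P.N) ≤ ξN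

/-- The slacks `(ξ, ξN)` are feasible at `x` in the problem that defines the predictive control
barrier function. -/
def FeasibleSlack (x : Vec n) (ξ : ℕ → Vec q) (ξN : ℝ) : Prop :=
  (∀ i < P.N, ∀ j, 0 ≤ ξ i j) ∧ 0 ≤ ξN ∧ ∃ xs us, P.FeasibleTraj x ξ ξN xs us

/-- The objective `α_f ξ_N + ∑_{i < N} ‖ξᵢ‖`. -/
noncomputable def cost (αf : ℝ) (ξ : ℕ → Vec q) (ξN : ℝ) : ℝ :=
  αf * ξN + ∑ i ∈ Finset.range P.N, ‖ξ i‖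

/-- The predictive control barrier function `h_PB`, the optimal value. -/
noncomputable def hPB (αf : ℝ) (x : Vec n) : ℝ :=
  sInf {J | ∃ ξ ξN, P.FeasibleSlack x ξ ξN ∧ J = P.cost αf ξ ξN}

/-- The domain `𝒟_PB`. -/
def domainPB (αf : ℝ) : Set (Vec n) := {x | P.hPB αf x ≤ αf * P.γf}

/-- The safe set `𝒮_PB`. -/
def safePB (αf : ℝ) : Set (Vec n) := {x | P.hPB αf x = 0}

/-! ### The approximate-PCBF safety filter -/

/-- The maximal decrease `max_{u ∈ U} (ĥ(x) - ĥ(f(x, u, 0)))`. -/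
noncomputable def maxDecrease (hhat : Vec n → ℝ) (x : Vec n) : ℝ :=
  sSup ((fun u => hhat x - hhat (P.f x u 0)) '' P.U)

open Classical in
/-- The factor of the decrease: `1` if the maximal decrease is negative, the hyperparameter `c`
otherwise. -/
noncomputable def decreaseFactor (c : ℝ) (hhat : Vec n → ℝ) (x : Vec n) : ℝ :=
  if P.maxDecrease hhat x < 0 then 1 else c

/-- The feasible inputs of the approximate safety filter problem at `x`. -/
def filterInputs (c : ℝ) (hhat : Vec n → ℝ) (x : Vec n) : Set (Vec m) :=
  {u ∈ P.U | hhat (P.f x u 0) - hhat x ≤ -(P.decreaseFactor c hhat x * P.maxDecrease hhat x)}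

/-- The proposed input is certified: `u_p ∈ U` and `ĥ(f(x, u_p, 0)) ≤ 0`. -/
def Certified (hhat : Vec n → ℝ) (x : Vec n) (up : Vec m) : Prop :=
  up ∈ P.U ∧ hhat (P.f x up 0) ≤ 0

/-- `u` is an input that the approximate-PCBF safety filter may apply in the state `x` when `up`
is proposed: `up` itself if it is certified, otherwise a minimiser of `‖u - up‖` over the feasible
inputs. -/
def ApproxFilterApplies (c : ℝ) (hhat : Vec n → ℝ) (x : Vec n) (up u : Vec m) : Prop :=
  (P.Certified hhat x up ∧ u = up) ∨
  (¬ P.Certified hhat x up ∧ u ∈ P.filterInputs c hhat x ∧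
    ∀ v ∈ P.filterInputs c hhat x, ‖u - up‖ ≤ ‖v - up‖)

/-- The closed loop with the approximate-PCBF safety filter, for arbitrary proposed inputs. -/
def approxLoop (c : ℝ) (hhat : Vec n → ℝ) (x : Vec n) (w : Vec p) : Set (Vec n) :=
  {y | ∃ up u, P.ApproxFilterApplies c hhat x up u ∧ y = P.f x u w}

/-! ### The original PCBF algorithm -/

/-- `(ξ, ξN)` are optimal slacks at `x`. -/
def OptimalSlack (αf : ℝ) (x : Vec n) (ξ : ℕ → Vec q) (ξN : ℝ) : Prop :=
  P.FeasibleSlack x ξ ξN ∧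
    ∀ ξ' ξN', P.FeasibleSlack x ξ' ξN' → P.cost αf ξ ξN ≤ P.cost αf ξ' ξN'

/-- `u` is an input that the PCBF algorithm may apply in the state `x` when `up` is proposed:
optimal slacks are computed first, then the first predicted input is brought as close to `up` as
possible subject to the predictive constraints with these slacks. -/
def PCBFApplies (αf : ℝ) (x : Vec n) (up u : Vec m) : Prop :=
  ∃ ξ ξN, P.OptimalSlack αf x ξ ξN ∧
    ∃ xs us, P.FeasibleTraj x ξ ξN xs us ∧ u = us 0 ∧
      ∀ ys vs, P.FeasibleTraj x ξ ξN ys vs → ‖us 0 - up‖ ≤ ‖vs 0 - up‖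

/-- The closed loop with the original PCBF algorithm, for arbitrary proposed inputs. -/
def pcbfLoop (αf : ℝ) (x : Vec n) (w : Vec p) : Set (Vec n) :=
  {y | ∃ up u, P.PCBFApplies αf x up u ∧ y = P.f x u w}

end Problem

end PCBF

namespace PCBF

/-! ### Compactness and comparison functions -/

/-! The function `hPB` is itself a Lyapunov function for both loops. For fixed inputs the cheapest
slacks are positive parts, so `hPB` is the minimum of a continuous cost over a compact product of
copies of `U`. Hence `hPB` is continuous and minimisers exist.

Nominal decrease (`hPB_successor`): drop the first input of an optimal sequence and append an input
supplied by the terminal barrier function. Every remaining stage is now judged by a smaller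
tightening, and the old terminal state pays a stage cost. That cost can be nonzero only away from
the terminal safe set. There compactness bounds the decrease of `hf` below, so a large `αf`
compensates (`exists_terminalDominates`). The decrease is strict wherever `hPB` is positive, and
compactness of the set of pairs (state, optimal sequence) makes it uniform on `r ≤ hPB`
(`exists_uniform_decrease`). No continuity or uniqueness of minimisers is needed.

The filter keeps a fraction `c` of this decrease up to an error `4 * ε`
(`ApproxFilterApplies.le_sub_add`), and a small disturbance raises `hPB` by little, uniformly on the
compact domain. Thus small inputs make the state enter and stay near the safe set, in uniform time.
Large inputs are harmless because trajectories remain in a compact domain. `exists_gains` converts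
these two facts into comparison functions. All constants depend only on `hPB` and `c`, so the gains
serve every `hhat`, `ε` and `W`. -/

theorem exists_pos_le_of_isCompact {X : Type*} [TopologicalSpace X] {K : Set X} (hK : IsCompact K)
    {g : X → ℝ} (hg : ContinuousOn g K) (hpos : ∀ x ∈ K, 0 < g x) :
    ∃ δ > 0, ∀ x ∈ K, δ ≤ g x := by
  rcases K.eq_empty_or_nonempty with rfl | hne
  · exact ⟨1, one_pos, by simp⟩
  · obtain ⟨x, hx, hmin⟩ := hK.exists_isMinOn hne hg
    exact ⟨g x, hpos x hx, fun y hy => hmin hy⟩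

/-- This is how every uniform constant below arises: a strict inequality on a closed part of a
compact set has a positive margin. -/
theorem exists_pos_le_of_le {X : Type*} [TopologicalSpace X] {K : Set X} (hK : IsCompact K)
    {f g : X → ℝ} (hf : Continuous f) (hg : Continuous g) {r : ℝ}
    (hpos : ∀ x ∈ K, r ≤ f x → 0 < g x) :
    ∃ δ > 0, ∀ x ∈ K, r ≤ f x → δ ≤ g x := by
  obtain ⟨δ, hδ, h⟩ := exists_pos_le_of_isCompact
    (hK.inter_right (isClosed_le (continuous_const (y := r)) hf)) hg.continuousOn
    (fun x hx => hpos x hx.1 hx.2)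
  exact ⟨δ, hδ, fun x hx hr => h x ⟨hx, hr⟩⟩

/-- A bounded relation `R r a` in which `a` is small when `r` is small is majorised by a
class `𝒦` function. -/
theorem exists_classK_majorant {R : ℝ → ℝ → Prop} {M : ℝ} (hr : ∀ r a, R r a → 0 ≤ r)
    (hM : ∀ r a, R r a → a ≤ M)
    (hsmall : ∀ η > 0, ∃ δ > 0, ∀ r a, R r a → r < δ → a ≤ η) :
    ∃ σ, IsClassK σ ∧ ∀ r a, R r a → a ≤ σ r := by
  obtain ⟨B, hB, hMB⟩ : ∃ B : ℝ, 0 < B ∧ M ≤ B := ⟨max M 1, by positivity, le_max_left _ _⟩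
  -- The majorant is a sum of ramps of heights `B / 2 ^ k`, the ramp `k` saturating at `δ k`. The
  -- extra summand `s` makes it strictly increasing.
  choose δ hδ hδR using fun k : ℕ => hsmall (B * (1 / 2) ^ (k + 1)) (by positivity)
  have hterm : ∀ k s, 0 ≤ s → 0 ≤ B * (1 / 2) ^ k * min 1 (s / δ k) := fun k s hs => by
    have := hδ k
    positivity
  have hbd : ∀ (k : ℕ) (s : Set.Ici (0 : ℝ)),
      ‖B * (1 / 2) ^ k * min 1 (s.1 / δ k)‖ ≤ B * (1 / 2) ^ k := fun k s => by
    rw [Real.norm_of_nonneg (hterm k s s.2)]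
    exact mul_le_of_le_one_right (by positivity) (min_le_left _ _)
  have hsumm : Summable fun k : ℕ => B * (1 / 2 : ℝ) ^ k :=
    (summable_geometric_of_lt_one (by norm_num) (by norm_num)).mul_left B
  have hsum : ∀ s, 0 ≤ s → Summable fun k => B * (1 / 2) ^ k * min 1 (s / δ k) := fun s hs =>
    Summable.of_norm_bounded hsumm fun k => hbd k ⟨s, hs⟩
  refine ⟨fun s => s + ∑' k, B * (1 / 2) ^ k * min 1 (s / δ k), ⟨?_, ?_, ?_⟩, ?_⟩
  · refine continuousOn_id.add (continuousOn_iff_continuous_domRestrict.2 ?_)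
    refine continuous_tsum (fun k => ?_) hsumm hbd
    fun_prop
  · intro s hs t ht hst
    refine add_lt_add_of_lt_of_le hst ((hsum s hs).tsum_le_tsum (fun k => ?_) (hsum t ht))
    have := hδ k
    gcongr
  · simp
  · intro r a hR
    have hr0 := hr r a hR
    have hts : 0 ≤ ∑' k, B * (1 / 2) ^ k * min 1 (r / δ k) := tsum_nonneg fun k => hterm k r hr0
    rcases le_or_gt a 0 with ha | ha
    · exact ha.trans (add_nonneg hr0 hts)
    have hex : ∃ k, δ k ≤ r := by
      by_contra! hcon
      obtain ⟨k, hk⟩ := exists_pow_lt_of_lt_one (div_pos ha hB)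
        (show (1 / 2 : ℝ) < 1 by norm_num)
      have h1 := hδR k r a hR (hcon k)
      rw [lt_div_iff₀ hB] at hk
      have h2 : (1 / 2 : ℝ) ^ (k + 1) * B ≤ (1 / 2) ^ k * B := by
        gcongr ?_ * B
        exact pow_le_pow_of_le_one (by norm_num) (by norm_num) (Nat.le_succ k)
      linarith
    classical
    -- For the least `k` with `δ k ≤ r`, the failure at `k - 1` (or the bound `M` if `k = 0`) gives
    -- `a ≤ B / 2 ^ k`, and the saturated ramp `k` alone contributes that much.
    have hk := Nat.find_spec hex
    have hmin := fun j hj => Nat.find_min hex (m := j) hj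
    generalize Nat.find hex = k at hk hmin
    have h1 : a ≤ B * (1 / 2) ^ k := by
      cases k with
      | zero => simpa using (hM r a hR).trans hMB
      | succ k => exact hδR k r a hR (not_le.1 (hmin k (Nat.lt_succ_self k)))
    have h2 : B * (1 / 2) ^ k * min 1 (r / δ k) = B * (1 / 2) ^ k := by
      rw [min_eq_left ((one_le_div (hδ k)).2 hk), mul_one]
    have h3 := (hsum r hr0).le_tsum k fun j _ => hterm j r hr0
    simp only [h2] at h3
    linarith

theorem IsClassK.nonneg {σ : ℝ → ℝ} (h : IsClassK σ) {s : ℝ} (hs : 0 ≤ s) : 0 ≤ σ s :=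
  h.map_zero ▸ h.strictMonoOn.monotoneOn (Set.mem_Ici.2 le_rfl) hs hs

theorem IsClassK.isClassKL_sqrt {σ : ℝ → ℝ} (h : IsClassK σ) :
    IsClassKL fun s t => σ (√(s / (t + 1))) where
  classK t := by
    have ht : (0 : ℝ) < t + 1 := by positivity
    refine ⟨?_, ?_, by simp [h.map_zero]⟩
    · refine h.continuousOn.comp (by fun_prop) fun s _ => Real.sqrt_nonneg _
    · intro s hs s' hs' hss
      refine h.strictMonoOn (Real.sqrt_nonneg _) (Real.sqrt_nonneg _) ?_
      exact Real.sqrt_lt_sqrt (div_nonneg hs ht.le) (by gcongr)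
  antitone s hs t t' htt := by
    refine h.strictMonoOn.monotoneOn (Real.sqrt_nonneg _) (Real.sqrt_nonneg _) ?_
    gcongr
  tendsto_zero s hs := by
    have h1 : Filter.Tendsto (fun t : ℕ => √(s / ((t : ℝ) + 1))) Filter.atTop
        (nhdsWithin 0 (Set.Ici 0)) := by
      refine tendsto_nhdsWithin_iff.2 ⟨?_, Filter.Eventually.of_forall fun _ => Real.sqrt_nonneg _⟩
      have h2 := (tendsto_one_div_add_atTop_nhds_zero_nat (𝕜 := ℝ)).const_mul s
      simpa [div_eq_mul_inv] using h2.sqrt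
    have h2 := (h.continuousOn 0 (Set.mem_Ici.2 le_rfl)).tendsto
    rw [h.map_zero] at h2
    exact h2.comp h1

/-- Stability and attractivity for small inputs, uniformly over bounded configurations
`(a, s, t, e)` of final distance, initial distance, time and input size, give gains. -/
theorem exists_gains {R : ℝ → ℝ → ℕ → ℝ → Prop} {M : ℝ}
    (hs : ∀ a s t e, R a s t e → 0 ≤ s) (he : ∀ a s t e, R a s t e → 0 ≤ e)
    (hM : ∀ a s t e, R a s t e → a ≤ M)
    (hstab : ∀ η > 0, ∃ δ > 0, ∀ a s t e, R a s t e → s < δ → e < δ → a ≤ η)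
    (hattr : ∀ η > 0, ∃ T : ℕ, ∃ δ > 0, ∀ a s t e, R a s t e → T ≤ t → e < δ → a ≤ η) :
    ∃ β σ, IsClassKL β ∧ IsClassK σ ∧ ∀ a s t e, R a s t e → a ≤ β s t + σ e := by
  -- The three parameters are merged into one number. It is small only if `e` is small and either
  -- `s` is small (stability applies) or `t` is large (attractivity applies).
  obtain ⟨σ, hσ, hmaj⟩ := exists_classK_majorant (M := M)
    (R := fun r a => ∃ s t e, R a s t e ∧ r = max (min s (1 / ((t : ℝ) + 1))) e)
    (by
      rintro r a ⟨s, t, e, h, rfl⟩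
      exact le_max_of_le_right (he _ _ _ _ h))
    (by
      rintro r a ⟨s, t, e, h, rfl⟩
      exact hM _ _ _ _ h)
    (by
      intro η hη
      obtain ⟨δ₁, hδ₁, h₁⟩ := hstab η hη
      obtain ⟨T, δ₂, hδ₂, h₂⟩ := hattr η hη
      refine ⟨min (min δ₁ δ₂) (1 / ((T : ℝ) + 1)), by positivity, ?_⟩
      rintro r a ⟨s, t, e, h, rfl⟩ hlt
      obtain ⟨hmin, he'⟩ := max_lt_iff.1 hlt
      obtain ⟨he', -⟩ := lt_min_iff.1 he'
      obtain ⟨he₁, he₂⟩ := lt_min_iff.1 he'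
      rcases min_lt_iff.1 hmin with hs' | ht
      · exact h₁ _ _ _ _ h (hs'.trans_le ((min_le_left _ _).trans (min_le_left _ _))) he₁
      · refine h₂ _ _ _ _ h ?_ he₂
        by_contra! htT
        have h3 : (1 : ℝ) / (T + 1) ≤ 1 / (t + 1) := by gcongr
        exact absurd (ht.trans_le (min_le_right _ _)) (not_lt.2 h3))
  refine ⟨_, σ, hσ.isClassKL_sqrt, hσ, fun a s t e h => ?_⟩
  have hs0 := hs _ _ _ _ h
  have he0 := he _ _ _ _ h
  refine (hmaj _ a ⟨s, t, e, h, rfl⟩).trans ?_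
  -- The minimum is not strictly increasing in `s`; the geometric mean dominates it and is.
  have hm : min s (1 / ((t : ℝ) + 1)) ≤ √(s / (t + 1)) := by
    refine Real.le_sqrt_of_sq_le ?_
    have h0 : 0 ≤ min s (1 / ((t : ℝ) + 1)) := by positivity
    calc _ = min s (1 / ((t : ℝ) + 1)) * min s (1 / ((t : ℝ) + 1)) := sq _
      _ ≤ s * (1 / (t + 1)) := by
        gcongr
        · exact min_le_left _ _
        · exact min_le_right _ _
      _ = _ := by ring
  have h1 := hσ.nonneg (Real.sqrt_nonneg (s / (t + 1)))
  have h2 := hσ.nonneg he0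
  rcases max_cases (min s (1 / ((t : ℝ) + 1))) e with ⟨h3, -⟩ | ⟨h3, -⟩ <;> rw [h3]
  · have := hσ.strictMonoOn.monotoneOn (show 0 ≤ min s (1 / ((t : ℝ) + 1)) by positivity)
      (Real.sqrt_nonneg _) hm
    linarith
  · linarith

/-! ### Input-to-state stability from a Lyapunov function -/

/-- If small inputs admit only small increases of `V`, and force a uniform decrease of `V` where
it is not small, then sublevel sets of `V` are invariant and reached in uniform time under small
inputs. -/
theorem sublevel_of_step {X : Type*} {V : X → ℝ} {D : Set X} {Step : X → X → Prop} {r ρ : ℝ}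
    (hρ : 0 < ρ)
    (hinc : ∀ x ∈ D, ∀ y ∈ D, Step x y → V y ≤ V x + r)
    (hdec : ∀ x ∈ D, ∀ y ∈ D, Step x y → r ≤ V x → V y ≤ V x - ρ)
    {x : ℕ → X} {i : ℕ} (hxD : ∀ k ≤ i, x k ∈ D) (hx : ∀ k < i, Step (x k) (x (k + 1))) :
    V (x i) ≤ 2 * r ∨ V (x i) ≤ V (x 0) - i * ρ := by
  induction i with
  | zero => right; simp
  | succ i ih =>
    have hi := hxD i (Nat.le_succ i)
    have hi' := hxD (i + 1) le_rfl
    have hst := hx i (Nat.lt_succ_self i)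
    have h1 := hinc _ hi _ hi' hst
    have h2 := hdec _ hi _ hi' hst
    push_cast
    -- From below `r` a single step reaches at most `2 * r`; from above `r` it decreases, so either
    -- alternative persists.
    rcases le_or_gt r (V (x i)) with hle | hlt
    · have h3 := h2 hle
      rcases ih (fun k hk => hxD k (hk.trans (Nat.le_succ i)))
        (fun k hk => hx k (hk.trans (Nat.lt_succ_self i))) with h4 | h4
      · left; linarith
      · right; linarith
    · left; linarith

theorem exists_iss_gains {n : ℕ} {V : Vec n → ℝ} (hV : Continuous V) (hV0 : ∀ x, 0 ≤ V x)
    {D S : Set (Vec n)} (hD : IsCompact D) (hS : IsCompact S) (hSne : S.Nonempty)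
    (hSV : ∀ x, x ∈ S ↔ V x = 0) {Step : ℝ → Vec n → Vec n → Prop}
    (hstep : ∀ r > 0, ∃ ρ > 0, ∃ δ > 0, ∀ e < δ, ∀ x ∈ D, ∀ y ∈ D, Step e x y →
      V y ≤ V x + r ∧ (r ≤ V x → V y ≤ V x - ρ)) :
    ∃ β σ, IsClassKL β ∧ IsClassK σ ∧ ∀ e, 0 ≤ e → ∀ (x : ℕ → Vec n) (i : ℕ),
      (∀ k ≤ i, x k ∈ D) → (∀ k < i, Step e (x k) (x (k + 1))) →
      Metric.infDist (x i) S ≤ β (Metric.infDist (x 0) S) i + σ e := by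
  have hdist : Continuous fun x : Vec n => Metric.infDist x S := Metric.continuous_infDist_pt S
  have hpos : ∀ x, 0 < V x ↔ 0 < Metric.infDist x S := fun x => by
    rw [← hS.isClosed.notMem_iff_infDist_pos hSne, hSV, (hV0 x).lt_iff_ne', ne_eq]
  obtain ⟨M, hM⟩ := (hD.image hdist).bddAbove
  obtain ⟨B, hB⟩ := (hD.image hV).bddAbove
  have small : ∀ η > 0, ∃ r > 0, ∀ x ∈ D, V x ≤ 2 * r → Metric.infDist x S ≤ η := by
    intro η hη
    obtain ⟨δ, hδ, h⟩ := exists_pos_le_of_le hD hdist hV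
      (fun x _ (hx : η ≤ _) => (hpos x).2 (hη.trans_le hx))
    refine ⟨δ / 4, by positivity, fun x hx hVx => ?_⟩
    by_contra! hcon
    linarith [h x hx hcon.le]
  obtain ⟨β, σ, hβ, hσ, h⟩ := exists_gains (M := M) (R := fun a s t e => 0 ≤ e ∧
      ∃ x : ℕ → Vec n, a = Metric.infDist (x t) S ∧ s = Metric.infDist (x 0) S ∧
        (∀ k ≤ t, x k ∈ D) ∧ (∀ k < t, Step e (x k) (x (k + 1))))
    (by
      rintro _ _ t e ⟨-, x, rfl, rfl, -⟩
      exact Metric.infDist_nonneg)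
    (fun _ _ _ _ h => h.1)
    (by
      rintro _ _ t e ⟨-, x, rfl, rfl, hx, -⟩
      exact hM ⟨_, hx t le_rfl, rfl⟩)
    (by
      intro η hη
      obtain ⟨r, hr, hsm⟩ := small η hη
      obtain ⟨ρ, hρ, δ, hδ, hst⟩ := hstep r hr
      -- Starting within `δ'` of `S` forces `V (x 0) < r`, so both alternatives of
      -- `sublevel_of_step` stay below `2 * r`.
      obtain ⟨δ', hδ', h'⟩ := exists_pos_le_of_le hD hV hdist
        (fun x _ (hx : r ≤ _) => (hpos x).1 (hr.trans_le hx))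
      refine ⟨min δ δ', by positivity, ?_⟩
      rintro _ _ t e ⟨-, x, rfl, rfl, hx, hxs⟩ hs he
      have hV0' : V (x 0) < r := by
        by_contra! hcon
        exact absurd (h' _ (hx 0 (Nat.zero_le t)) hcon) (not_le.2 (hs.trans_le (min_le_right _ _)))
      have hst' := hst e (he.trans_le (min_le_left _ _))
      refine hsm _ (hx t le_rfl) ?_
      rcases sublevel_of_step hρ (fun x hx y hy h => (hst' x hx y hy h).1)
        (fun x hx y hy h => (hst' x hx y hy h).2) hx hxs with h1 | h1
      · exact h1
      · have : 0 ≤ (t : ℝ) * ρ := by positivity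
        linarith)
    (by
      intro η hη
      obtain ⟨r, hr, hsm⟩ := small η hη
      obtain ⟨ρ, hρ, δ, hδ, hst⟩ := hstep r hr
      -- After `T` steps the alternative of linear decrease has used up the bound `B` on `V` and
      -- gives `V ≤ 0`.
      obtain ⟨T, hT⟩ := exists_nat_ge (B / ρ)
      refine ⟨T, δ, hδ, ?_⟩
      rintro _ _ t e ⟨-, x, rfl, rfl, hx, hxs⟩ hTt he
      refine hsm _ (hx t le_rfl) ?_
      have hst' := hst e he
      rcases sublevel_of_step hρ (fun x hx y hy h => (hst' x hx y hy h).1)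
        (fun x hx y hy h => (hst' x hx y hy h).2) hx hxs with h1 | h1
      · exact h1
      · have h2 : V (x 0) ≤ B := hB ⟨_, hx 0 (Nat.zero_le t), rfl⟩
        rw [div_le_iff₀ hρ] at hT
        have h3 : (T : ℝ) * ρ ≤ t * ρ := by gcongr
        linarith)
  exact ⟨β, σ, hβ, hσ, fun e he x i hx hxs => h _ _ _ _ ⟨he, x, rfl, rfl, hx, hxs⟩⟩

/-! ### Positive parts of tightened constraints -/

section Slack

variable {n q : ℕ}

/-- The least non-negative `ξ` with `v ≤ -t 𝟏 + ξ`. -/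
noncomputable def leastSlack (v : Vec q) (t : ℝ) : Vec q :=
  WithLp.toLp 2 fun j => max (v j + t) 0

@[simp] theorem leastSlack_apply (v : Vec q) (t : ℝ) (j : Fin q) :
    leastSlack v t j = max (v j + t) 0 := rfl

theorem norm_le_norm_of_le {v w : Vec q} (hv : ∀ j, 0 ≤ v j) (h : ∀ j, v j ≤ w j) :
    ‖v‖ ≤ ‖w‖ := by
  rw [EuclideanSpace.norm_eq, EuclideanSpace.norm_eq]
  refine Real.sqrt_le_sqrt (Finset.sum_le_sum fun j _ => ?_)
  rw [Real.norm_of_nonneg (hv j), Real.norm_of_nonneg ((hv j).trans (h j))]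
  exact pow_le_pow_left₀ (hv j) (h j) 2

theorem leastSlack_nonneg (v : Vec q) (t : ℝ) (j : Fin q) : 0 ≤ leastSlack v t j :=
  le_max_right _ _

theorem norm_leastSlack_le {v ξ : Vec q} {t : ℝ} (hξ : ∀ j, 0 ≤ ξ j) (h : ∀ j, v j ≤ -t + ξ j) :
    ‖leastSlack v t‖ ≤ ‖ξ‖ :=
  norm_le_norm_of_le (leastSlack_nonneg v t) fun j => max_le (by linarith [h j]) (hξ j)

theorem norm_leastSlack_mono (v : Vec q) {t t' : ℝ} (h : t ≤ t') :
    ‖leastSlack v t‖ ≤ ‖leastSlack v t'‖ :=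
  norm_le_norm_of_le (leastSlack_nonneg v t) fun j => max_le_max_right 0 (by linarith)

/-- A nonzero component of the larger slack is a positive `v j + t'`, and its positive part drops
strictly when `t'` is lowered. -/
theorem norm_leastSlack_lt (v : Vec q) {t t' : ℝ} (h : t < t') (hpos : 0 < ‖leastSlack v t'‖) :
    ‖leastSlack v t‖ < ‖leastSlack v t'‖ := by
  obtain ⟨j, hj⟩ : ∃ j, leastSlack v t' j ≠ 0 := by
    by_contra! hcon
    exact norm_ne_zero_iff.1 hpos.ne' (PiLp.ext hcon)
  rw [EuclideanSpace.norm_eq, EuclideanSpace.norm_eq]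
  have key : ∀ i, leastSlack v t i ≤ leastSlack v t' i := fun i =>
    max_le_max_right 0 (by linarith)
  refine Real.sqrt_lt_sqrt (by positivity) (Finset.sum_lt_sum (fun i _ => ?_)
    ⟨j, Finset.mem_univ j, ?_⟩)
  · rw [Real.norm_of_nonneg (leastSlack_nonneg v t i),
      Real.norm_of_nonneg (leastSlack_nonneg v t' i)]
    exact pow_le_pow_left₀ (leastSlack_nonneg v t i) (key i) 2
  · rw [Real.norm_of_nonneg (leastSlack_nonneg v t j),
      Real.norm_of_nonneg (leastSlack_nonneg v t' j)]
    refine pow_lt_pow_left₀ ?_ (leastSlack_nonneg v t j) two_ne_zero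
    have hj' : 0 < v j + t' := by
      by_contra! hle
      exact hj (max_eq_right hle)
    simp only [leastSlack_apply]
    exact max_lt (lt_max_of_lt_left (by linarith)) (lt_max_of_lt_left hj')

theorem leastSlack_eq_zero {v : Vec q} {t : ℝ} (h : ∀ j, v j ≤ -t) : leastSlack v t = 0 :=
  PiLp.ext fun j => max_eq_right (by linarith [h j])

theorem continuous_leastSlack {X : Type*} [TopologicalSpace X] {g : X → Vec q} (hg : Continuous g)
    (t : ℝ) : Continuous fun x => leastSlack (g x) t := by
  unfold leastSlack
  fun_prop

end Slack

namespace Problem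

variable {n m p q : ℕ} (P : Problem n m p q)

/-! ### Rollouts and the value function -/

/-- The states reached from `x` under the inputs `us` without disturbance. -/
noncomputable def rollout (x : Vec n) (us : ℕ → Vec m) : ℕ → Vec n
  | 0 => x
  | i + 1 => P.f (rollout x us i) (us i) 0

/-- The cost of the inputs `us` at `x` with the least feasible slacks. -/
noncomputable def rolloutCost (αf : ℝ) (x : Vec n) (us : ℕ → Vec m) : ℝ :=
  αf * max (P.hf (P.rollout x us P.N)) 0 +
    ∑ i ∈ Finset.range P.N, ‖leastSlack (P.c (P.rollout x us i)) (P.tight i)‖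

/-- The admissible input sequences. -/
def inputSeqs : Set (ℕ → Vec m) := Set.univ.pi fun _ => P.U

theorem mem_inputSeqs {us : ℕ → Vec m} : us ∈ P.inputSeqs ↔ ∀ i, us i ∈ P.U := by
  simp [inputSeqs]

theorem tight_mono {i j : ℕ} (hij : i ≤ j) (hj : j < P.N) : P.tight i ≤ P.tight j := by
  induction j, hij using Nat.le_induction with
  | base => exact le_rfl
  | succ j _ ih => exact (ih (by omega)).trans (P.tight_lt j hj).le

variable {P}

theorem continuous_rollout (i : ℕ) :
    Continuous fun z : Vec n × (ℕ → Vec m) => P.rollout z.1 z.2 i := by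
  induction i with
  | zero => exact continuous_fst
  | succ i ih =>
    exact P.continuous_f.comp (ih.prodMk (((continuous_apply i).comp continuous_snd).prodMk
      continuous_const))

theorem rollout_congr {x : Vec n} {us vs : ℕ → Vec m} {i : ℕ} (h : ∀ k < i, us k = vs k) :
    P.rollout x us i = P.rollout x vs i := by
  induction i with
  | zero => rfl
  | succ i ih =>
    simp only [rollout, h i (Nat.lt_succ_self i), ih fun k hk => h k (hk.trans (Nat.lt_succ_self i))]

theorem rollout_shift (x : Vec n) (us : ℕ → Vec m) (i : ℕ) :
    P.rollout (P.f x (us 0) 0) (fun k => us (k + 1)) i = P.rollout x us (i + 1) := by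
  induction i with
  | zero => rfl
  | succ i ih => rw [rollout, ih]; rfl

theorem FeasibleTraj.eq_rollout {x : Vec n} {ξ : ℕ → Vec q} {ξN : ℝ} {xs : ℕ → Vec n}
    {us : ℕ → Vec m} (h : P.FeasibleTraj x ξ ξN xs us) {i : ℕ} (hi : i ≤ P.N) :
    xs i = P.rollout x us i := by
  induction i with
  | zero => exact h.init
  | succ i ih => rw [h.dynamics i hi, ih (by omega), rollout]

theorem rolloutCost_nonneg {αf : ℝ} (hα : 0 ≤ αf) (x : Vec n) (us : ℕ → Vec m) :
    0 ≤ P.rolloutCost αf x us := by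
  unfold rolloutCost
  positivity

theorem feasibleSlack_rollout (x : Vec n) {us : ℕ → Vec m} (hus : us ∈ P.inputSeqs) :
    P.FeasibleSlack x (fun i => leastSlack (P.c (P.rollout x us i)) (P.tight i))
      (max (P.hf (P.rollout x us P.N)) 0) := by
  refine ⟨fun i _ j => leastSlack_nonneg _ _ j, le_max_right _ _, P.rollout x us, us, rfl,
    fun i _ => rfl, fun i _ => P.mem_inputSeqs.1 hus i, fun i _ j => ?_, le_max_left _ _⟩
  have := le_max_left (P.c (P.rollout x us i) j + P.tight i) 0
  rw [leastSlack_apply]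
  linarith

theorem FeasibleTraj.exists_rolloutCost_le {αf : ℝ} (hα : 0 ≤ αf) {x : Vec n} {ξ : ℕ → Vec q}
    {ξN : ℝ} {xs : ℕ → Vec n} {us : ℕ → Vec m} (h : P.FeasibleTraj x ξ ξN xs us)
    (hξ : ∀ i < P.N, ∀ j, 0 ≤ ξ i j) (hξN : 0 ≤ ξN) :
    ∃ vs ∈ P.inputSeqs, vs 0 = us 0 ∧ P.rolloutCost αf x vs ≤ P.cost αf ξ ξN := by
  have hN := P.one_le_N
  -- Entries of `us` from index `N` on need not lie in `U`; they are replaced by `us 0`, which does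
  -- since `1 ≤ N`.
  have hvs : ∀ i < P.N, us (if i < P.N then i else 0) = us i := fun i hi => by rw [if_pos hi]
  have hroll : ∀ i ≤ P.N, P.rollout x (fun i => us (if i < P.N then i else 0)) i = xs i :=
    fun i hi => by rw [h.eq_rollout hi]; exact rollout_congr fun k hk => hvs k (hk.trans_le hi)
  refine ⟨fun i => us (if i < P.N then i else 0), P.mem_inputSeqs.2 fun i => h.input _ ?_,
    hvs 0 hN, ?_⟩
  · split_ifs <;> omega
  · refine add_le_add (mul_le_mul_of_nonneg_left (max_le ?_ hξN) hα)
      (Finset.sum_le_sum fun i hi => ?_)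
    · rw [hroll _ le_rfl]
      exact h.terminal
    · rw [Finset.mem_range] at hi
      rw [hroll _ hi.le]
      exact norm_leastSlack_le (hξ i hi) (h.state i hi)

/-- Slacks range over an unbounded set. Eliminating them leaves a minimisation over the compact set
of input sequences, from which continuity of `hPB` and existence of minimisers follow. -/
theorem hPB_eq_sInf_rolloutCost {αf : ℝ} (hα : 0 ≤ αf) (hU : P.U.Nonempty) (x : Vec n) :
    P.hPB αf x = sInf (P.rolloutCost αf x '' P.inputSeqs) := by
  obtain ⟨u, hu⟩ := hU
  have hmem : (fun _ => u) ∈ P.inputSeqs := P.mem_inputSeqs.2 fun _ => hu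
  have hlow : ∀ J ∈ P.rolloutCost αf x '' P.inputSeqs, 0 ≤ J := by
    rintro _ ⟨us, -, rfl⟩
    exact rolloutCost_nonneg hα x us
  have key : ∀ J ∈ {J | ∃ ξ ξN, P.FeasibleSlack x ξ ξN ∧ J = P.cost αf ξ ξN},
      ∃ J' ∈ P.rolloutCost αf x '' P.inputSeqs, J' ≤ J := by
    rintro _ ⟨ξ, ξN, ⟨hξ, hξN, xs, us, h⟩, rfl⟩
    obtain ⟨vs, hvs, -, hle⟩ := h.exists_rolloutCost_le hα hξ hξN
    exact ⟨_, ⟨vs, hvs, rfl⟩, hle⟩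
  refine le_antisymm (le_csInf ⟨_, _, hmem, rfl⟩ ?_) (le_csInf ?_ fun J hJ => ?_)
  · rintro _ ⟨us, hus, rfl⟩
    refine csInf_le ⟨0, fun J hJ => ?_⟩ ⟨_, _, feasibleSlack_rollout x hus, rfl⟩
    obtain ⟨J', hJ', hle⟩ := key J hJ
    exact (hlow J' hJ').trans hle
  · exact ⟨_, _, _, feasibleSlack_rollout x hmem, rfl⟩
  · obtain ⟨J', hJ', hle⟩ := key J hJ
    exact (csInf_le ⟨0, hlow⟩ hJ').trans hle

theorem hPB_le_rolloutCost {αf : ℝ} (hα : 0 ≤ αf) (x : Vec n) {us : ℕ → Vec m}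
    (hus : us ∈ P.inputSeqs) : P.hPB αf x ≤ P.rolloutCost αf x us := by
  rw [hPB_eq_sInf_rolloutCost hα ⟨us 0, P.mem_inputSeqs.1 hus 0⟩]
  refine csInf_le ⟨0, ?_⟩ ⟨us, hus, rfl⟩
  rintro _ ⟨us, -, rfl⟩
  exact rolloutCost_nonneg hα x us

theorem hPB_nonneg {αf : ℝ} (hα : 0 ≤ αf) (hU : P.U.Nonempty) (x : Vec n) : 0 ≤ P.hPB αf x := by
  rw [hPB_eq_sInf_rolloutCost hα hU]
  refine Real.sInf_nonneg ?_
  rintro _ ⟨us, -, rfl⟩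
  exact rolloutCost_nonneg hα x us

/-- Optimal slacks are attained along an input sequence of optimal rollout cost with the same
first input. -/
theorem PCBFApplies.exists_inputSeq {αf : ℝ} (hα : 0 ≤ αf) {x : Vec n} {up u : Vec m}
    (h : P.PCBFApplies αf x up u) :
    ∃ us ∈ P.inputSeqs, us 0 = u ∧ P.rolloutCost αf x us = P.hPB αf x := by
  obtain ⟨ξ, ξN, ⟨⟨hξ, hξN, -⟩, hopt⟩, xs, us, htraj, rfl, -⟩ := h
  obtain ⟨vs, hvs, hv0, hle⟩ := htraj.exists_rolloutCost_le hα hξ hξN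
  have hU : P.U.Nonempty := ⟨vs 0, P.mem_inputSeqs.1 hvs 0⟩
  refine ⟨vs, hvs, hv0, le_antisymm ?_ (hPB_le_rolloutCost hα x hvs)⟩
  rw [hPB_eq_sInf_rolloutCost hα hU]
  refine le_csInf ⟨_, vs, hvs, rfl⟩ ?_
  rintro _ ⟨ws, hws, rfl⟩
  exact hle.trans (hopt _ _ (feasibleSlack_rollout x hws))

theorem ConstraintSets.isCompact_inputSeqs (hcon : P.ConstraintSets) : IsCompact P.inputSeqs :=
  isCompact_univ_pi fun _ => hcon.isCompact_U

theorem continuous_rolloutCost (hcon : P.ConstraintSets) (hhf : Continuous P.hf) (αf : ℝ) :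
    Continuous fun z : Vec n × (ℕ → Vec m) => P.rolloutCost αf z.1 z.2 := by
  unfold rolloutCost
  refine ((((hhf.comp (continuous_rollout _)).max continuous_const)).const_mul _).add
    (continuous_finsetSum _ fun i _ => ?_)
  exact (continuous_leastSlack (hcon.continuous_c.comp (continuous_rollout i)) _).norm

theorem continuous_hPB (hcon : P.ConstraintSets) (hhf : Continuous P.hf) (hU : P.U.Nonempty)
    {αf : ℝ} (hα : 0 ≤ αf) : Continuous (P.hPB αf) := by
  simp_rw [funext (hPB_eq_sInf_rolloutCost hα hU)]
  exact hcon.isCompact_inputSeqs.continuous_sInf (continuous_rolloutCost hcon hhf αf)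

theorem exists_rolloutCost_eq_hPB (hcon : P.ConstraintSets) (hhf : Continuous P.hf)
    (hU : P.U.Nonempty) {αf : ℝ} (hα : 0 ≤ αf) (x : Vec n) :
    ∃ us ∈ P.inputSeqs, P.rolloutCost αf x us = P.hPB αf x := by
  obtain ⟨u, hu⟩ := hU
  rw [hPB_eq_sInf_rolloutCost hα ⟨u, hu⟩]
  refine (hcon.isCompact_inputSeqs.image_of_continuousOn ?_).sInf_mem
    (Set.Nonempty.image _ ⟨fun _ => u, P.mem_inputSeqs.2 fun _ => hu⟩)
  exact ((continuous_rolloutCost hcon hhf αf).comp (Continuous.prodMk_right x)).continuousOn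

/-- As `tight 0 = 0`, the slack of stage `0` bounds each component of `c x` by `hPB x`, so the
domain lies in a compact soft-constrained set. -/
theorem isCompact_domainPB (hcon : P.ConstraintSets) (hhf : Continuous P.hf) (hU : P.U.Nonempty)
    {αf : ℝ} (hα : 0 ≤ αf) : IsCompact (P.domainPB αf) := by
  refine (hcon.isCompact_softSet (WithLp.toLp 2 fun _ => αf * P.γf)
    fun _ => mul_nonneg hα P.γf_pos.le).of_isClosed_subset
    (isClosed_le (continuous_hPB hcon hhf hU hα) continuous_const) fun x hx j => ?_
  obtain ⟨us, -, hJ⟩ := exists_rolloutCost_eq_hPB hcon hhf hU hα x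
  have h0 : ‖leastSlack (P.c x) (P.tight 0)‖ ≤ P.rolloutCost αf x us := by
    have := Finset.single_le_sum (f := fun i =>
      ‖leastSlack (P.c (P.rollout x us i)) (P.tight i)‖) (fun i _ => norm_nonneg _)
      (Finset.mem_range.2 (Nat.lt_of_lt_of_le Nat.zero_lt_one P.one_le_N))
    refine this.trans (le_add_of_nonneg_left ?_)
    positivity
  have h1 := (Real.le_norm_self _).trans (PiLp.norm_apply_le (leastSlack (P.c x) (P.tight 0)) j)
  have h2 := le_max_left (P.c x j + P.tight 0) 0
  rw [leastSlack_apply] at h1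
  have h3 : P.hPB αf x ≤ αf * P.γf := hx
  rw [P.tight_zero, add_zero] at h2
  rw [P.tight_zero, add_zero] at h1
  show P.c x j ≤ αf * P.γf
  rw [P.tight_zero] at h0
  linarith

end Problem

/-! ### Decrease of the predictive control barrier function -/

/-- The admissible inputs form a compact set, so the infimum is attained. The empty set is excluded
because its infimum `⊤` exceeds the real number `a`. -/
theorem exists_le_of_iInf_le {n m : ℕ} {g : Vec m → Vec n} {U : Set (Vec m)} {h : Vec n → ℝ}
    {D : Set (Vec n)} (hU : IsCompact U) (hD : IsClosed D) (hg : Continuous g) (hh : Continuous h)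
    {a : ℝ} (hle : (⨅ u ∈ {u ∈ U | g u ∈ D}, (h (g u) : EReal)) ≤ (a : EReal)) :
    ∃ u ∈ U, h (g u) ≤ a := by
  have hA : IsCompact {u ∈ U | g u ∈ D} := hU.inter_right (hD.preimage hg)
  rcases Set.eq_empty_or_nonempty {u ∈ U | g u ∈ D} with hE | hne
  · rw [hE] at hle
    simp at hle
  · obtain ⟨u, hu, hmin⟩ := hA.exists_isMinOn hne (hh.comp hg).continuousOn
    refine ⟨u, hu.1, EReal.coe_le_coe_iff.1 ((le_iInf₂ fun v hv => ?_).trans hle)⟩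
    exact EReal.coe_le_coe_iff.2 (hmin hv)

namespace Problem

variable {n m p q : ℕ} {P : Problem n m p q}

theorem continuous_nominal (x : Vec n) : Continuous fun u => P.f x u 0 :=
  P.continuous_f.comp (by fun_prop : Continuous fun u : Vec m => (x, u, (0 : Vec p)))

theorem TerminalCBF.exists_safe_input (hterm : P.TerminalCBF) (hcon : P.ConstraintSets) {x : Vec n}
    (hx : P.hf x ≤ 0) : ∃ u ∈ P.U, P.hf (P.f x u 0) ≤ 0 := by
  obtain ⟨-, -, -, hD, -, -, dh, -, -, -, hsafe⟩ := hterm.isCBF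
  refine exists_le_of_iInf_le hcon.isCompact_U hD.isClosed (continuous_nominal x)
    hterm.continuous_hf ?_
  simpa using hsafe x hx

theorem TerminalCBF.nonempty_U (hterm : P.TerminalCBF) (hcon : P.ConstraintSets) :
    P.U.Nonempty := by
  obtain ⟨x, hx⟩ := hterm.isCBF.2.2.1
  obtain ⟨u, hu, -⟩ := hterm.exists_safe_input hcon hx
  exact ⟨u, hu⟩

/-- With the weight `αf`, the decrease of the terminal function on its domain outweighs the
violation of the last tightened constraint. -/
def TerminalDominates (P : Problem n m p q) (αf : ℝ) : Prop :=
  ∀ x, P.hf x ≤ P.γf → ∃ u ∈ P.U,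
    αf * max (P.hf (P.f x u 0)) 0 + ‖leastSlack (P.c x) (P.tight (P.N - 1))‖ ≤
      αf * max (P.hf x) 0 ∧
    (0 < P.hf x → αf * max (P.hf (P.f x u 0)) 0 + ‖leastSlack (P.c x) (P.tight (P.N - 1))‖ <
      αf * max (P.hf x) 0)

theorem exists_terminalDominates (hcon : P.ConstraintSets) (hterm : P.TerminalCBF) :
    ∃ αbar > 0, ∀ αf ≥ αbar, P.TerminalDominates αf := by
  obtain ⟨-, -, -, hD, -, -, dh, hdh, hdpos, hdec, -⟩ := hterm.isCBF
  set t := P.tight (P.N - 1)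
  have hopen : IsOpen {x | ∀ j, P.c x j < -t} := by
    simp only [Set.ofPred_forall]
    exact isOpen_iInter_of_finite fun j => isOpen_lt
      ((PiLp.continuous_apply 2 _ j).comp hcon.continuous_c) continuous_const
  have hpos : ∀ x ∈ P.terminalDomain ∩ {x | ∀ j, P.c x j < -t}ᶜ, 0 < P.hf x := by
    rintro x ⟨-, hx⟩
    by_contra! hle
    exact hx (hterm.safe_inside x hle)
  -- Taking the minimum with `hf` makes `ρ` bound the decrease of `max hf 0`, even if the successor
  -- has negative `hf`.
  obtain ⟨ρ, hρ, hρle⟩ := exists_pos_le_of_isCompact (hD.inter_right hopen.isClosed_compl)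
    (g := fun x => min (dh x) (P.hf x))
    ((hdh.mono Set.inter_subset_left).inf hterm.continuous_hf.continuousOn)
    (fun x hx => lt_min (hdpos x hx.1 (hpos x hx)) (hpos x hx))
  obtain ⟨B, hB⟩ := (hD.image (continuous_leastSlack hcon.continuous_c t).norm).bddAbove
  -- With this weight `αf * ρ` strictly exceeds the bound `B` on the last stage cost.
  refine ⟨(max B 0 + 1) / ρ, by positivity, fun αf hα x hx => ?_⟩
  have hα0 : 0 < αf := lt_of_lt_of_le (by positivity) hα
  have hBx : ‖leastSlack (P.c x) t‖ ≤ B := hB ⟨x, hx, rfl⟩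
  rcases le_or_gt (P.hf x) 0 with hx0 | hx0
  · obtain ⟨u, hu, hfu⟩ := hterm.exists_safe_input hcon hx0
    refine ⟨u, hu, ?_, fun h => absurd h (not_lt.2 hx0)⟩
    rw [leastSlack_eq_zero fun j => (hterm.safe_inside x hx0 j).le, max_eq_right hfu,
      max_eq_right hx0]
    simp
  · obtain ⟨u, hu, hfu⟩ := exists_le_of_iInf_le hcon.isCompact_U hD.isClosed
      (continuous_nominal x) hterm.continuous_hf (hdec x hx hx0)
    suffices h : αf * max (P.hf (P.f x u 0)) 0 + ‖leastSlack (P.c x) t‖ < αf * max (P.hf x) 0 from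
      ⟨u, hu, h.le, fun _ => h⟩
    rw [max_eq_left hx0.le]
    by_cases hin : ∀ j, P.c x j < -t
    · rw [leastSlack_eq_zero fun j => (hin j).le, norm_zero, add_zero]
      refine mul_lt_mul_of_pos_left (max_lt ?_ hx0) hα0
      linarith [hdpos x hx hx0]
    · obtain ⟨h1, h2⟩ := le_min_iff.1 (hρle x ⟨hx, hin⟩)
      have h3 : max (P.hf (P.f x u 0)) 0 ≤ P.hf x - ρ := max_le (by linarith) (by linarith)
      have h4 := mul_le_mul_of_nonneg_left h3 hα0.le
      have h5 : max B 0 + 1 ≤ αf * ρ := (div_le_iff₀ hρ).1 hα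
      linarith [le_max_left B 0]

theorem hPB_successor {αf : ℝ} (hα : 0 < αf)
    (hdom : P.TerminalDominates αf) {x : Vec n} {us : ℕ → Vec m} (hus : us ∈ P.inputSeqs)
    (hJ : P.rolloutCost αf x us ≤ αf * P.γf) :
    P.hPB αf (P.f x (us 0) 0) ≤ P.rolloutCost αf x us ∧
      (0 < P.rolloutCost αf x us →
        P.hPB αf (P.f x (us 0) 0) < P.rolloutCost αf x us) := by
  obtain ⟨M, hM⟩ : ∃ M, P.N = M + 1 := ⟨P.N - 1, (Nat.sub_add_cancel P.one_le_N).symm⟩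
  have hz : P.hf (P.rollout x us P.N) ≤ P.γf := by
    have h1 : αf * max (P.hf (P.rollout x us P.N)) 0 ≤ P.rolloutCost αf x us :=
      le_add_of_nonneg_right (by positivity)
    exact (le_max_left _ _).trans (le_of_mul_le_mul_left (h1.trans hJ) hα)
  obtain ⟨u, hu, hle, hlt⟩ := hdom _ hz
  obtain ⟨vs, hvs⟩ : ∃ vs : ℕ → Vec m, vs = fun i => if i < P.N then us i else u := ⟨_, rfl⟩
  have hvsU : ∀ i, vs i ∈ P.U := fun i => by
    rw [hvs]
    dsimp only
    split_ifs
    exacts [P.mem_inputSeqs.1 hus i, hu]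
  have hroll : ∀ i ≤ P.N, P.rollout x vs i = P.rollout x us i := fun i hi =>
    rollout_congr fun k hk => by rw [hvs]; exact if_pos (hk.trans_le hi)
  have hv0 : vs 0 = us 0 := by rw [hvs]; exact if_pos P.one_le_N
  have hlast : P.rollout x vs (P.N + 1) = P.f (P.rollout x us P.N) u 0 := by
    rw [rollout, hroll _ le_rfl, hvs]
    simp
  have hcand := hPB_le_rolloutCost hα.le (P.f x (us 0) 0)
    (us := fun k => vs (k + 1)) (P.mem_inputSeqs.2 fun i => hvsU (i + 1))
  -- Stage `i` of the shifted run visits the old state `i + 1`, formerly tightened by `tight (i +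
  -- 1)`. The old terminal state becomes stage `N - 1`.
  have hnew : P.rolloutCost αf (P.f x (us 0) 0) (fun k => vs (k + 1)) =
      αf * max (P.hf (P.f (P.rollout x us P.N) u 0)) 0 +
        (∑ i ∈ Finset.range M, ‖leastSlack (P.c (P.rollout x us (i + 1))) (P.tight i)‖ +
          ‖leastSlack (P.c (P.rollout x us P.N)) (P.tight (P.N - 1))‖) := by
    rw [rolloutCost, ← hv0]
    simp only [rollout_shift, hlast]
    congr 1
    rw [hM, Finset.sum_range_succ]
    simp only [Nat.add_sub_cancel]
    congr 1
    · refine Finset.sum_congr rfl fun i hi => ?_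
      rw [Finset.mem_range] at hi
      rw [hroll _ (by omega)]
    · rw [hroll _ (by omega)]
  have hold : P.rolloutCost αf x us = αf * max (P.hf (P.rollout x us P.N)) 0 +
      (∑ i ∈ Finset.range M, ‖leastSlack (P.c (P.rollout x us (i + 1))) (P.tight (i + 1))‖ +
        ‖leastSlack (P.c x) (P.tight 0)‖) := by
    rw [rolloutCost]
    congr 1
    rw [hM, Finset.sum_range_succ']
    rfl
  have htight : ∀ i ∈ Finset.range M, P.tight i < P.tight (i + 1) := fun i hi =>
    P.tight_lt i (by rw [Finset.mem_range] at hi; omega)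
  have hsum := Finset.sum_le_sum fun i (hi : i ∈ Finset.range M) =>
    norm_leastSlack_mono (P.c (P.rollout x us (i + 1))) (htight i hi).le
  have h0 := norm_nonneg (leastSlack (P.c x) (P.tight 0))
  refine ⟨by linarith, fun hpos => ?_⟩
  -- A positive cost has a positive terminal part, a positive stage `0`, which is discarded, or a
  -- positive later stage, whose relaxed tightening lowers it strictly.
  rcases lt_or_ge 0 (P.hf (P.rollout x us P.N)) with hz0 | hz0
  · linarith [hlt hz0]
  rcases h0.lt_or_eq with h0 | h0
  · linarith
  have hex : ∃ i ∈ Finset.range M,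
      0 < ‖leastSlack (P.c (P.rollout x us (i + 1))) (P.tight (i + 1))‖ := by
    by_contra! hcon
    have := Finset.sum_nonpos hcon
    rw [max_eq_right hz0, mul_zero] at hold
    linarith
  obtain ⟨i, hi, hpos'⟩ := hex
  have := Finset.sum_lt_sum (fun i (hi : i ∈ Finset.range M) =>
    norm_leastSlack_mono (P.c (P.rollout x us (i + 1))) (htight i hi).le)
    ⟨i, hi, norm_leastSlack_lt _ (htight i hi) hpos'⟩
  linarith

/-- From a terminally safe state, safe inputs keep `hf ≤ 0` forever. There `c` lies below `-tight (N
- 1)`, hence below every `-tight i`, and no slack is needed. -/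
theorem exists_hPB_eq_zero (hcon : P.ConstraintSets) (hterm : P.TerminalCBF) {αf : ℝ}
    (hα : 0 ≤ αf) : (P.safePB αf).Nonempty := by
  obtain ⟨x, hx⟩ := hterm.isCBF.2.2.1
  have hU := hterm.nonempty_U hcon
  choose! κ hκU hκ using fun y (hy : P.hf y ≤ 0) => hterm.exists_safe_input hcon hy
  let z : ℕ → Vec n := fun i => Nat.rec x (fun _ y => P.f y (κ y) 0) i
  have hz : ∀ i, P.hf (z i) ≤ 0 := fun i => by
    induction i with
    | zero => exact hx
    | succ i ih => exact hκ _ ih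
  have hroll : ∀ i, P.rollout x (fun k => κ (z k)) i = z i := fun i => by
    induction i with
    | zero => rfl
    | succ i ih => rw [rollout, ih]
  have hJ : P.rolloutCost αf x (fun k => κ (z k)) = 0 := by
    simp only [rolloutCost, hroll, max_eq_right (hz _), mul_zero, zero_add]
    refine Finset.sum_eq_zero fun i hi => ?_
    rw [Finset.mem_range] at hi
    rw [leastSlack_eq_zero, norm_zero]
    intro j
    have h1 := hterm.safe_inside _ (hz i) j
    have h2 := P.tight_mono (show i ≤ P.N - 1 by omega) (by omega)
    linarith
  refine ⟨x, le_antisymm ?_ (hPB_nonneg hα hU x)⟩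
  rw [← hJ]
  exact hPB_le_rolloutCost hα x (P.mem_inputSeqs.2 fun i => hκU _ (hz i))

theorem safePB_subset_domainPB {αf : ℝ} (hα : 0 ≤ αf) : P.safePB αf ⊆ P.domainPB αf :=
  fun x (hx : P.hPB αf x = 0) => hx.trans_le (mul_nonneg hα P.γf_pos.le)

/-- The inputs that start an input sequence of optimal rollout cost. -/
def optimalInputs (P : Problem n m p q) (αf : ℝ) (x : Vec n) : Set (Vec m) :=
  {u | ∃ us ∈ P.inputSeqs, us 0 = u ∧ P.rolloutCost αf x us = P.hPB αf x}

theorem hPB_le_of_mem_optimalInputs {αf : ℝ} (hα : 0 < αf) (hdom : P.TerminalDominates αf) {x : Vec n} (hx : x ∈ P.domainPB αf) {u : Vec m}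
    (hu : u ∈ P.optimalInputs αf x) : P.hPB αf (P.f x u 0) ≤ P.hPB αf x := by
  obtain ⟨us, hus, rfl, hJ⟩ := hu
  rw [← hJ]
  exact (hPB_successor hα hdom hus (hJ.trans_le hx)).1

theorem exists_uniform_decrease (hcon : P.ConstraintSets) (hterm : P.TerminalCBF) {αf : ℝ}
    (hα : 0 < αf) (hdom : P.TerminalDominates αf) {r : ℝ} (hr : 0 < r) :
    ∃ ρ > 0, ∀ x ∈ P.domainPB αf, r ≤ P.hPB αf x → ∀ u ∈ P.optimalInputs αf x,
      P.hPB αf (P.f x u 0) ≤ P.hPB αf x - ρ := by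
  have hhf := hterm.continuous_hf
  have hU := hterm.nonempty_U hcon
  have hh : Continuous (P.hPB αf) := continuous_hPB hcon hhf hU hα.le
  have hfst : Continuous fun z : Vec n × (ℕ → Vec m) => P.hPB αf z.1 := hh.comp continuous_fst
  have hK : IsCompact ((P.domainPB αf ×ˢ P.inputSeqs) ∩
      {z | P.rolloutCost αf z.1 z.2 = P.hPB αf z.1}) :=
    ((isCompact_domainPB hcon hhf hU hα.le).prod hcon.isCompact_inputSeqs).inter_right
      (isClosed_eq (continuous_rolloutCost hcon hhf αf) hfst)
  have hnext : Continuous fun z : Vec n × (ℕ → Vec m) => P.hPB αf (P.f z.1 (z.2 0) 0) :=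
    hh.comp (P.continuous_f.comp (by fun_prop :
      Continuous fun z : Vec n × (ℕ → Vec m) => (z.1, z.2 0, (0 : Vec p))))
  obtain ⟨ρ, hρ, h⟩ := exists_pos_le_of_le hK hfst (hfst.sub hnext) (r := r) (by
    rintro ⟨x, us⟩ ⟨⟨hx, hus⟩, hJ : _ = _⟩ (hrx : r ≤ P.hPB αf x)
    have := (hPB_successor hα hdom hus (hJ.trans_le hx)).2
      (by rw [hJ]; exact hr.trans_le hrx)
    rw [hJ] at this
    exact sub_pos.2 this)
  refine ⟨ρ, hρ, ?_⟩
  rintro x hx hrx _ ⟨us, hus, rfl, hJ⟩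
  have : ρ ≤ P.hPB αf x - P.hPB αf (P.f x (us 0) 0) := h (x, us) ⟨⟨hx, hus⟩, hJ⟩ hrx
  linarith

/-- Within the unit ball of disturbances, those raising `h` by at least `r` belong to a compact set
avoiding `w = 0`. The resulting `δ` does not involve `W`. -/
theorem exists_disturbance_bound (hcon : P.ConstraintSets) {D : Set (Vec n)} (hD : IsCompact D)
    {h : Vec n → ℝ} (hh : Continuous h) {r : ℝ} (hr : 0 < r) :
    ∃ δ > 0, ∀ x ∈ D, ∀ u ∈ P.U, ∀ w : Vec p, ‖w‖ < δ →
      h (P.f x u w) ≤ h (P.f x u 0) + r := by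
  have h1 : Continuous fun z : Vec n × Vec m × Vec p => h (P.f z.1 z.2.1 z.2.2) :=
    hh.comp P.continuous_f
  have h2 : Continuous fun z : Vec n × Vec m × Vec p => h (P.f z.1 z.2.1 0) :=
    hh.comp (P.continuous_f.comp (by fun_prop :
      Continuous fun z : Vec n × Vec m × Vec p => (z.1, z.2.1, (0 : Vec p))))
  obtain ⟨δ, hδ, hle⟩ := exists_pos_le_of_le
    (hD.prod (hcon.isCompact_U.prod (isCompact_closedBall (0 : Vec p) 1)))
    (h1.sub h2) (g := fun z => ‖z.2.2‖) (by fun_prop) (r := r) (by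
      rintro ⟨x, u, w⟩ - (hz : r ≤ h (P.f x u w) - h (P.f x u 0))
      refine norm_pos_iff.2 ?_
      rintro (rfl : w = 0)
      linarith)
  refine ⟨min δ 1, by positivity, fun x hx u hu w hw => ?_⟩
  obtain ⟨hwδ, hw1⟩ := lt_min_iff.1 hw
  by_contra! hcon
  have : δ ≤ ‖w‖ := hle (x, u, w) ⟨hx, hu, by simpa using hw1.le⟩
    (show r ≤ h (P.f x u w) - h (P.f x u 0) by linarith)
  linarith

/-! ### The approximate filter -/

theorem ApproxFilterApplies.mem_U {c : ℝ} {hhat : Vec n → ℝ} {x : Vec n} {up u : Vec m}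
    (h : P.ApproxFilterApplies c hhat x up u) : u ∈ P.U := by
  rcases h with ⟨h, rfl⟩ | ⟨-, h, -⟩
  exacts [h.1, h.1]

/-- The filter transfers a nominal decrease `d` of `h` to the applied input, up to the
approximation error and the factor `c`. -/
theorem ApproxFilterApplies.le_sub_add {c ε d : ℝ} (hc0 : 0 < c) (hc1 : c ≤ 1)
    (hU : IsCompact P.U) {h hhat : Vec n → ℝ} (hhat_cont : Continuous hhat) (h0 : ∀ x, 0 ≤ h x)
    {D : Set (Vec n)} (hε : ∀ x ∈ D, |h x - hhat x| ≤ ε)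
    {x : Vec n} (hx : x ∈ D)
    (hinv : ∀ up u, P.ApproxFilterApplies c hhat x up u → P.f x u 0 ∈ D)
    (hd : 0 ≤ d) {u₀ : Vec m} (hu₀ : u₀ ∈ P.U) (hu₀D : P.f x u₀ 0 ∈ D)
    (hdec : h (P.f x u₀ 0) ≤ h x - d) {up u : Vec m}
    (hu : P.ApproxFilterApplies c hhat x up u) :
    h (P.f x u 0) ≤ h x - c * d + 4 * ε := by
  have hεx := abs_le.1 (hε x hx)
  have hεu := abs_le.1 (hε _ (hinv up u hu))
  have hcd : c * d ≤ d := mul_le_of_le_one_left hd hc1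
  have hε0 : 0 ≤ ε := (abs_nonneg _).trans (hε x hx)
  rcases hu with ⟨hcert, rfl⟩ | ⟨-, hmem, -⟩
  -- A certified input gives `h ≤ ε` at the successor, while `h x - c * d` is nonnegative because `d
  -- ≤ h x`.
  · linarith [hcert.2, h0 (P.f x u₀ 0)]
  · have hεu₀ := abs_le.1 (hε _ hu₀D)
    have hmax : hhat x - hhat (P.f x u₀ 0) ≤ P.maxDecrease hhat x := by
      refine le_csSup (hU.image_of_continuousOn ?_).bddAbove ⟨u₀, hu₀, rfl⟩
      exact (continuous_const.sub (hhat_cont.comp (continuous_nominal x))).continuousOn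
    -- The maximal decrease of `hhat` is at least `d - 2 * ε`. If it is negative, the factor `1`
    -- keeps this bound; otherwise the factor `c` scales it. Returning from `hhat` to `h` costs
    -- another `2 * ε`.
    have hlow : c * d - 2 * ε ≤ P.decreaseFactor c hhat x * P.maxDecrease hhat x := by
      unfold decreaseFactor
      split_ifs
      · linarith
      · have h1 : c * (d - 2 * ε) ≤ c * P.maxDecrease hhat x :=
          mul_le_mul_of_nonneg_left (by linarith) hc0.le
        have h2 : c * ε ≤ ε := mul_le_of_le_one_left hε0 hc1
        linarith
    linarith [hmem.2]

/-! ### Input-to-state stability of the closed loops -/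

theorem norm_le_truncNorm (w : ℕ → Vec p) {j i : ℕ} (hj : j < i) : ‖w j‖ ≤ truncNorm w i := by
  have := Finset.le_sup (f := fun j => ‖w j‖₊) (Finset.mem_range.2 hj)
  exact_mod_cast this

/-- A loop `f(x, u, w)` with inputs `u` from `A` satisfies the estimates once `A` transfers
uniform decreases of `h_PB`. -/
theorem exists_loop_gains (hcon : P.ConstraintSets) (hterm : P.TerminalCBF) {αf : ℝ} (hα : 0 < αf)
    {A : ℝ → Vec n → Set (Vec m)} (hAU : ∀ ε x, A ε x ⊆ P.U)
    (hA : ∀ r > 0, ∃ ρ > 0, ∀ ε, ∀ x ∈ P.domainPB αf, ∀ u ∈ A ε x, 0 ≤ ε ∧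
      P.hPB αf (P.f x u 0) ≤ P.hPB αf x + 4 * ε ∧
      (r ≤ P.hPB αf x → P.hPB αf (P.f x u 0) ≤ P.hPB αf x - ρ + 4 * ε)) :
    ∃ β σ, IsClassKL β ∧ IsClassK σ ∧ ∀ ε, 0 ≤ ε → ∀ (w : ℕ → Vec p) (x : ℕ → Vec n),
      (∀ k, x k ∈ P.domainPB αf) → (∀ k, ∃ u ∈ A ε (x k), x (k + 1) = P.f (x k) u (w k)) →
      ∀ i, Metric.infDist (x i) (P.safePB αf) ≤
        β (Metric.infDist (x 0) (P.safePB αf)) i + σ (max (truncNorm w i) ε) := by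
  have hhf := hterm.continuous_hf
  have hU := hterm.nonempty_U hcon
  have hh : Continuous (P.hPB αf) := continuous_hPB hcon hhf hU hα.le
  have hD := isCompact_domainPB hcon hhf hU hα.le
  obtain ⟨β, σ, hβ, hσ, hest⟩ := exists_iss_gains hh (hPB_nonneg hα.le hU) hD
    (hD.of_isClosed_subset (isClosed_eq hh continuous_const) (safePB_subset_domainPB hα.le))
    (exists_hPB_eq_zero hcon hterm hα.le) (fun x => Iff.rfl)
    (Step := fun e x y => ∃ ε ≤ e, ∃ w : Vec p, ‖w‖ ≤ e ∧ ∃ u ∈ A ε x, y = P.f x u w) (by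
      intro r hr
      obtain ⟨ρ, hρ, hAρ⟩ := hA r hr
      -- The disturbance and the error `4 * ε` each cost at most `min r ρ / 4`, so any increase
      -- stays below `r` and half of `ρ` survives.
      obtain ⟨δ, hδ, hdist⟩ := exists_disturbance_bound hcon hD hh
        (show 0 < min r ρ / 4 by positivity)
      refine ⟨ρ / 2, by positivity, min δ (min r ρ / 16), by positivity, ?_⟩
      rintro e he x hx _ - ⟨ε, hε, w, hw, u, hu, rfl⟩
      obtain ⟨heδ, her⟩ := lt_min_iff.1 he
      obtain ⟨-, h1, h2⟩ := hAρ ε x hx u hu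
      have h3 := hdist x hx u (hAU ε x hu) w (hw.trans_lt heδ)
      have h4 := min_le_left r ρ
      have h5 := min_le_right r ρ
      exact ⟨by linarith, fun hrx => by linarith [h2 hrx]⟩)
  refine ⟨β, σ, hβ, hσ, fun ε hε w x hx hstep i => ?_⟩
  refine hest _ (le_max_of_le_right hε) x i (fun k _ => hx k) fun k hk => ?_
  obtain ⟨u, hu, hxu⟩ := hstep k
  exact ⟨ε, le_max_right _ _, w k, (norm_le_truncNorm w hk).trans (le_max_left _ _), u, hu, hxu⟩

theorem mem_of_isSolution {F : Vec n → Vec p → Set (Vec n)} {W : Set (Vec p)} {D : Set (Vec n)}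
    (hinv : RobustlyPositivelyInvariant F W D) {w : ℕ → Vec p} (hw : ∀ k, w k ∈ W)
    {x : ℕ → Vec n} (hx0 : x 0 ∈ D) (hx : IsSolution F w x) (k : ℕ) : x k ∈ D := by
  induction k with
  | zero => exact hx0
  | succ k ih => exact hinv _ (hw k) _ ih (hx k)

theorem optimalInputs_subset (αf : ℝ) (x : Vec n) : P.optimalInputs αf x ⊆ P.U := by
  rintro _ ⟨us, hus, rfl, -⟩
  exact P.mem_inputSeqs.1 hus 0

theorem optimalInputs_nonempty (hcon : P.ConstraintSets) (hterm : P.TerminalCBF) {αf : ℝ}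
    (hα : 0 < αf) (x : Vec n) : (P.optimalInputs αf x).Nonempty := by
  obtain ⟨us, hus, hJ⟩ := exists_rolloutCost_eq_hPB hcon hterm.continuous_hf
    (hterm.nonempty_U hcon) hα.le x
  exact ⟨us 0, us, hus, rfl, hJ⟩

theorem isCompact_safePB (hcon : P.ConstraintSets) (hterm : P.TerminalCBF) {αf : ℝ}
    (hα : 0 < αf) : IsCompact (P.safePB αf) :=
  have hU := hterm.nonempty_U hcon
  (isCompact_domainPB hcon hterm.continuous_hf hU hα.le).of_isClosed_subset
    (isClosed_eq (continuous_hPB hcon hterm.continuous_hf hU hα.le) continuous_const)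
    (safePB_subset_domainPB hα.le)

/-- The approximate filter transfers the nominal decreases of `h_PB`. -/
theorem hPB_le_of_approxFilterApplies (hcon : P.ConstraintSets) (hterm : P.TerminalCBF) {αf : ℝ}
    (hα : 0 < αf) (hdom : P.TerminalDominates αf) {c ε : ℝ} (hc0 : 0 < c) (hc1 : c ≤ 1)
    {hhat : Vec n → ℝ} (hcont : Continuous hhat)
    (hε : ∀ x ∈ P.domainPB αf, |P.hPB αf x - hhat x| ≤ ε) {W : Set (Vec p)} (hW : 0 ∈ W)
    (hinv : RobustlyPositivelyInvariant (P.approxLoop c hhat) W (P.domainPB αf))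
    {x : Vec n} (hx : x ∈ P.domainPB αf) {up u : Vec m} (hu : P.ApproxFilterApplies c hhat x up u)
    {d : ℝ} (hd : 0 ≤ d) {u₀ : Vec m} (hu₀ : u₀ ∈ P.optimalInputs αf x)
    (hdec : P.hPB αf (P.f x u₀ 0) ≤ P.hPB αf x - d) :
    P.hPB αf (P.f x u 0) ≤ P.hPB αf x - c * d + 4 * ε :=
  hu.le_sub_add hc0 hc1 hcon.isCompact_U hcont (hPB_nonneg hα.le (hterm.nonempty_U hcon)) hε hx
    (fun up u h => hinv 0 hW x hx ⟨up, u, h, rfl⟩) hd (optimalInputs_subset αf x hu₀)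
    ((hPB_le_of_mem_optimalInputs hα hdom hx hu₀).trans hx) hdec

theorem exists_approxLoop_gains (hcon : P.ConstraintSets) (hterm : P.TerminalCBF) {αf : ℝ}
    (hα : 0 < αf) (hdom : P.TerminalDominates αf) {c : ℝ} (hc0 : 0 < c) (hc1 : c ≤ 1) :
    ∃ β σ, IsClassKL β ∧ IsClassK σ ∧ ∀ hhat : Vec n → ℝ, Continuous hhat →
      ∀ ε : ℝ, (∀ x ∈ P.domainPB αf, |P.hPB αf x - hhat x| ≤ ε) →
      ∀ W : Set (Vec p), 0 ∈ W →
        RobustlyPositivelyInvariant (P.approxLoop c hhat) W (P.domainPB αf) →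
        IsISSWith β σ (P.approxLoop c hhat) W (P.domainPB αf) (P.safePB αf) ε := by
  have hU := hterm.nonempty_U hcon
  have hnonneg := hPB_nonneg hα.le hU
  have hle := fun x (hx : x ∈ P.domainPB αf) u => hPB_le_of_mem_optimalInputs hα hdom hx
    (u := u)
  -- The set `A` records only the transfer inequality, without `hhat` or `W`, so the gains are fixed
  -- before either is chosen. Its case `d = 0` bounds the increase.
  obtain ⟨β, σ, hβ, hσ, hest⟩ := exists_loop_gains hcon hterm hα
    (A := fun ε x => {u ∈ P.U | 0 ≤ ε ∧ ∀ d, 0 ≤ d → ∀ u₀ ∈ P.optimalInputs αf x,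
      P.hPB αf (P.f x u₀ 0) ≤ P.hPB αf x - d → P.hPB αf (P.f x u 0) ≤ P.hPB αf x - c * d + 4 * ε})
    (fun ε x u hu => hu.1) (by
      intro r hr
      obtain ⟨ρ, hρ, hdec⟩ := exists_uniform_decrease hcon hterm hα hdom hr
      refine ⟨c * ρ, by positivity, ?_⟩
      rintro ε x hx u ⟨-, hε, hu⟩
      obtain ⟨u₀, hu₀⟩ := optimalInputs_nonempty hcon hterm hα x
      refine ⟨hε, ?_, fun hrx => hu ρ hρ.le u₀ hu₀ (hdec x hx hrx u₀ hu₀)⟩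
      simpa using hu 0 le_rfl u₀ hu₀ (by simpa using hle x hx u₀ hu₀))
  refine ⟨β, σ, hβ, hσ, fun hhat hcont ε hε W hW hinv => ?_⟩
  have hsub := safePB_subset_domainPB (P := P) hα.le
  have hne := exists_hPB_eq_zero hcon hterm hα.le
  have hε0 : 0 ≤ ε := by
    obtain ⟨x, hx⟩ := hne
    exact (abs_nonneg _).trans (hε x (hsub hx))
  refine ⟨isCompact_domainPB hcon hterm.continuous_hf hU hα.le, hinv,
    isCompact_safePB hcon hterm hα, hne, hsub, ?_, ?_⟩
  · rintro rfl x hx _ ⟨up, u, hu, rfl⟩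
    obtain ⟨u₀, hu₀⟩ := optimalInputs_nonempty hcon hterm hα x
    have h1 := hPB_le_of_approxFilterApplies hcon hterm hα hdom hc0 hc1 hcont hε hW hinv (hsub hx)
      hu le_rfl hu₀ (by simpa using hle x (hsub hx) u₀ hu₀)
    have hx' : P.hPB αf x = 0 := hx
    exact le_antisymm (by simpa [hx'] using h1) (hnonneg _)
  · intro w hw x hx0 hx i
    have hxD := mem_of_isSolution hinv hw hx0 hx
    refine hest ε hε0 w x hxD (fun k => ?_) i
    obtain ⟨up, u, hu, hxu⟩ := hx k
    exact ⟨u, ⟨hu.mem_U, hε0, fun d hd u₀ hu₀ hdec =>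
      hPB_le_of_approxFilterApplies hcon hterm hα hdom hc0 hc1 hcont hε hW hinv (hxD k) hu hd hu₀
        hdec⟩, hxu⟩

theorem exists_pcbfLoop_gains (hcon : P.ConstraintSets) (hterm : P.TerminalCBF) {αf : ℝ}
    (hα : 0 < αf) (hdom : P.TerminalDominates αf) :
    ∃ β σ, IsClassKL β ∧ IsClassK σ ∧ ∀ W : Set (Vec p),
        RobustlyPositivelyInvariant (P.pcbfLoop αf) W (P.domainPB αf) →
        IsISSWith β σ (P.pcbfLoop αf) W (P.domainPB αf) (P.safePB αf) 0 := by
  have hU := hterm.nonempty_U hcon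
  obtain ⟨β, σ, hβ, hσ, hest⟩ := exists_loop_gains hcon hterm hα
    (A := fun ε x => {u ∈ P.optimalInputs αf x | 0 ≤ ε})
    (fun ε x u hu => optimalInputs_subset αf x hu.1) (by
      intro r hr
      obtain ⟨ρ, hρ, hdec⟩ := exists_uniform_decrease hcon hterm hα hdom hr
      refine ⟨ρ, hρ, ?_⟩
      rintro ε x hx u ⟨hu, hε⟩
      refine ⟨hε, ?_, fun hrx => ?_⟩
      · linarith [hPB_le_of_mem_optimalInputs hα hdom hx hu]
      · linarith [hdec x hx hrx u hu])
  refine ⟨β, σ, hβ, hσ, fun W hinv => ?_⟩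
  have hsub := safePB_subset_domainPB (P := P) hα.le
  refine ⟨isCompact_domainPB hcon hterm.continuous_hf hU hα.le, hinv,
    isCompact_safePB hcon hterm hα, exists_hPB_eq_zero hcon hterm hα.le, hsub, ?_, ?_⟩
  · rintro - x hx _ ⟨up, u, hu, rfl⟩
    have h1 := hPB_le_of_mem_optimalInputs hα hdom (hsub hx) (hu.exists_inputSeq hα.le)
    exact le_antisymm (h1.trans_eq hx) (hPB_nonneg hα.le hU _)
  · intro w hw x hx0 hx i
    refine hest 0 le_rfl w x (mem_of_isSolution hinv hw hx0 hx) (fun k => ?_) i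
    obtain ⟨up, u, hu, hxu⟩ := hx k
    exact ⟨u, ⟨hu.exists_inputSeq hα.le, le_rfl⟩, hxu⟩

end Problem

end PCBF

theorem mainTheorem1 {n m p q : ℕ} (P : PCBF.Problem n m p q)
    (hcon : P.ConstraintSets) (hterm : P.TerminalCBF) :
    ∃ αbar : ℝ, 0 < αbar ∧ ∀ αf : ℝ, αbar ≤ αf →
      (∀ cΔ : ℝ, 0 < cΔ → cΔ ≤ 1 →
        ∃ (β : ℝ → ℕ → ℝ) (σ : ℝ → ℝ), PCBF.IsClassKL β ∧ PCBF.IsClassK σ ∧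
          ∀ hhat : PCBF.Vec n → ℝ, Continuous hhat →
          ∀ ε : ℝ, (∀ x ∈ P.domainPB αf, |P.hPB αf x - hhat x| ≤ ε) →
          ∀ W : Set (PCBF.Vec p), IsCompact W → 0 ∈ W →
            PCBF.RobustlyPositivelyInvariant (P.approxLoop cΔ hhat) W (P.domainPB αf) →
            PCBF.IsISSWith β σ (P.approxLoop cΔ hhat) W (P.domainPB αf) (P.safePB αf) ε) ∧
      (∃ (β : ℝ → ℕ → ℝ) (σ : ℝ → ℝ), PCBF.IsClassKL β ∧ PCBF.IsClassK σ ∧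
          ∀ W : Set (PCBF.Vec p), IsCompact W → 0 ∈ W →
            PCBF.RobustlyPositivelyInvariant (P.pcbfLoop αf) W (P.domainPB αf) →
            PCBF.IsISSWith β σ (P.pcbfLoop αf) W (P.domainPB αf) (P.safePB αf) 0) := by
  obtain ⟨αbar, hpos, hdom⟩ := PCBF.Problem.exists_terminalDominates hcon hterm
  refine ⟨αbar, hpos, fun αf hα => ⟨fun cΔ hc0 hc1 => ?_, ?_⟩⟩
  · obtain ⟨β, σ, hβ, hσ, h⟩ := PCBF.Problem.exists_approxLoop_gains hcon hterm
      (hpos.trans_le hα) (hdom αf hα) hc0 hc1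
    exact ⟨β, σ, hβ, hσ, fun hhat hcont ε hε W _ hW => h hhat hcont ε hε W hW⟩
  · obtain ⟨β, σ, hβ, hσ, h⟩ := PCBF.Problem.exists_pcbfLoop_gains hcon hterm
      (hpos.trans_le hα) (hdom αf hα)
    exact ⟨β, σ, hβ, hσ, fun W _ _ => h W⟩
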